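/- **Lemma 1.** Let $\mathcal H_1,\mathcal H_2$ be Hermitian matrices or bounded Hermitian operators (or, more generally, arbitrary elements of a complex Banach algebra with unit), measured in a submultiplicative norm $\|\cdot\|$, and suppose that $\|\mathcal H_2\|\le\|\mathcal H_1\|=1$. For real $\Delta t$ set $$S_2(\Delta t)=e^{-i\mathcal H_1\Delta t/2}\,e^{-i\mathcal H_2\Delta t}\,e^{-i\mathcal H_1\Delta t/2},$$ and for $k\ge 2$ define recursively $$S_{2k}(\Delta t)=[S_{2k-2}(p_k\Delta t)]^2\,S_{2k-2}((1-4p_k)\Delta t)\,[S_{2k-2}(p_k\Delta t)]^2,\qquad p_k=\bigl(4-4^{1/(2k-1)}\bigr)^{-1}.$$ For $k\ge 1$ let $c_k=\tfrac83\,k\,(5/3)^{k-1}$. Then, for every integer $k\ge 1$ and every real $\Delta t$ with $c_k|\Delta t|\le k+1$, $$\bigl\|e^{-i(\mathcal H_1+\mathcal H_2)\Delta t}-S_{2k}(\Delta t)\bigr\|\le\frac{4\|\mathcal H_2\|}{(2k+1)!}\,(c_k|\Delta t|)^{2k+1}.$$ -/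

import Mathlib

noncomputable section

/-- The propagator `e^{-i H t}` generated by `H` for the real time `t`. -/
def propagator {A : Type*} [NormedRing A] [NormedAlgebra ℂ A] (H : A) (t : ℝ) : A :=
  NormedSpace.exp ((-(Complex.I * (t : ℂ))) • H)

/-- Suzuki's coefficient `p_k = (4 - 4^{1/(2k-1)})⁻¹`, used for `k ≥ 2`. -/
def suzukiP (k : ℕ) : ℝ :=
  (4 - (4 : ℝ) ^ (1 / (2 * (k : ℝ) - 1)))⁻¹

/-- `suzuki H₁ H₂ k Δt` is the Suzuki approximant `S_{2k}(H₁, H₂, Δt)`, for `k ≥ 1`: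
`S_2` is the Strang splitting, and `S_{2k}` is obtained recursively from `S_{2k-2}`.
The value at `k = 0` is a convention that is never used. -/
def suzuki {A : Type*} [NormedRing A] [NormedAlgebra ℂ A] (H₁ H₂ : A) : ℕ → ℝ → A
  | 0, _ => 1
  | 1, Δt => propagator H₁ (Δt / 2) * propagator H₂ Δt * propagator H₁ (Δt / 2)
  | (k + 2), Δt =>
      suzuki H₁ H₂ (k + 1) (suzukiP (k + 2) * Δt) ^ 2 *
        suzuki H₁ H₂ (k + 1) ((1 - 4 * suzukiP (k + 2)) * Δt) *
        suzuki H₁ H₂ (k + 1) (suzukiP (k + 2) * Δt) ^ 2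

/-- The constant `c_k = (8/3) k (5/3)^{k-1}`, for `k ≥ 1`. -/
def suzukiC (k : ℕ) : ℝ :=
  8 / 3 * (k : ℝ) * (5 / 3 : ℝ) ^ (k - 1)

end

/-! With `a = -i H₁` and `b = -i H₂`, both sides are everywhere convergent power series in the time,
so it suffices to compare coefficients.

Low degrees cancel (`suzukiSeries_agreesTo`): the choice of `p_k` kills the leading error, which has
odd degree, and time symmetry kills the next one, of even degree.

For the remaining degrees, both series reduce to `exp (aX)` when `b = 0`. Majorizing their distances
from it by differences of scalar exponentials keeps a factor `‖b‖`
(`norm_coeff_formalExp_sub_suzukiSeries_le`); the exponents grow only by the total weight of the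
composition (`suzukiWeight_le`). The hypothesis on `Δt` then dominates the tail by a geometric
series of ratio 1/2 (`norm_le_of_hasSum_pow_div_factorial`). -/

open Finset.HasAntidiagonal

set_option linter.unusedSectionVars false

/-! ### Formal power series: dilations and exponentials. -/

section Series

variable {A : Type*} [NormedRing A] [NormedAlgebra ℝ A]

/-- The ring endomorphism `F(X) ↦ F(cX)` of formal power series with coefficients in a possibly
noncommutative real algebra. -/
noncomputable def dilate (c : ℝ) : PowerSeries A →+* PowerSeries A where
  toFun F := PowerSeries.mk fun n => c ^ n • PowerSeries.coeff n F
  map_zero' := by ext; simp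
  map_add' F G := by ext; simp
  map_one' := by
    ext n
    by_cases h : n = 0 <;> simp [PowerSeries.coeff_one, h]
  map_mul' F G := by
    ext n
    simp only [PowerSeries.coeff_mk, PowerSeries.coeff_mul, Finset.smul_sum]
    refine Finset.sum_congr rfl fun p hp => ?_
    rw [smul_mul_smul_comm, ← pow_add, mem_antidiagonal.1 hp]

@[simp]
theorem coeff_dilate (c : ℝ) (F : PowerSeries A) (n : ℕ) :
    PowerSeries.coeff n (dilate c F) = c ^ n • PowerSeries.coeff n F := by
  simp [dilate]

theorem dilate_dilate (c d : ℝ) (F : PowerSeries A) :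
    dilate c (dilate d F) = dilate (c * d) F := by
  ext n
  simp [smul_smul, mul_pow]

/-- The formal power series `exp (aX)`. -/
noncomputable def formalExp (a : A) : PowerSeries A :=
  PowerSeries.mk fun n => ((n.factorial : ℝ)⁻¹) • a ^ n

@[simp]
theorem coeff_formalExp (a : A) (n : ℕ) :
    PowerSeries.coeff n (formalExp a) = ((n.factorial : ℝ)⁻¹) • a ^ n :=
  PowerSeries.coeff_mk _ _

theorem dilate_formalExp (c : ℝ) (a : A) : dilate c (formalExp a) = formalExp (c • a) := by
  ext n
  rw [coeff_dilate, coeff_formalExp, coeff_formalExp, smul_pow, smul_comm]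

@[simp]
theorem formalExp_zero : formalExp (0 : A) = 1 := by
  ext n
  by_cases h : n = 0 <;> simp [PowerSeries.coeff_one, h]

theorem choose_mul_inv_factorial {n i j : ℕ} (h : i + j = n) :
    (n.factorial : ℝ)⁻¹ * (n.choose i : ℝ) = (i.factorial : ℝ)⁻¹ * (j.factorial : ℝ)⁻¹ := by
  subst h
  have hi : (i.factorial : ℝ) ≠ 0 := by exact_mod_cast i.factorial_ne_zero
  have hj : (j.factorial : ℝ) ≠ 0 := by exact_mod_cast j.factorial_ne_zero
  have hn : ((i + j).factorial : ℝ) ≠ 0 := by exact_mod_cast (i + j).factorial_ne_zero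
  have key : (((i + j).choose i : ℕ) : ℝ) * i.factorial * j.factorial = (i + j).factorial := by
    have := Nat.choose_mul_factorial_mul_factorial (Nat.le_add_right i j)
    rw [Nat.add_sub_cancel_left] at this
    exact_mod_cast this
  field_simp
  linarith

theorem formalExp_mul_of_commute {a b : A} (h : Commute a b) :
    formalExp a * formalExp b = formalExp (a + b) := by
  ext n
  rw [PowerSeries.coeff_mul, coeff_formalExp, h.add_pow', Finset.smul_sum]
  refine Finset.sum_congr rfl fun p hp => ?_
  rw [coeff_formalExp, coeff_formalExp, smul_mul_smul_comm, ← Nat.cast_smul_eq_nsmul ℝ, smul_smul,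
    choose_mul_inv_factorial (mem_antidiagonal.1 hp)]

theorem formalExp_smul_mul_smul (a : A) (c d : ℝ) :
    formalExp (c • a) * formalExp (d • a) = formalExp ((c + d) • a) := by
  rw [formalExp_mul_of_commute (((Commute.refl a).smul_left c).smul_right d), add_smul]

theorem sum_antidiagonal_pow_div_factorial (u v : ℝ) (n : ℕ) :
    ∑ p ∈ antidiagonal n, u ^ p.1 / (p.1.factorial : ℝ) * (v ^ p.2 / (p.2.factorial : ℝ)) =
      (u + v) ^ n / (n.factorial : ℝ) := by
  rw [(Commute.all u v).add_pow', div_eq_inv_mul, Finset.mul_sum]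
  refine Finset.sum_congr rfl fun p hp => ?_
  rw [nsmul_eq_mul, ← mul_assoc, choose_mul_inv_factorial (mem_antidiagonal.1 hp)]
  ring

/-! ### Majorization by scalar exponentials. -/

theorem norm_mul_pow_le (x a : A) (n : ℕ) : ‖x * a ^ n‖ ≤ ‖x‖ * ‖a‖ ^ n := by
  induction n with
  | zero => simp
  | succ n ih =>
    rw [pow_succ, ← mul_assoc, pow_succ, ← mul_assoc]
    exact (norm_mul_le _ _).trans (by gcongr)

theorem norm_pow_mul_le_pow_norm_mul (a x : A) (n : ℕ) : ‖a ^ n * x‖ ≤ ‖a‖ ^ n * ‖x‖ := by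
  induction n with
  | zero => simp
  | succ n ih =>
    rw [pow_succ', mul_assoc, pow_succ', mul_assoc]
    exact (norm_mul_le _ _).trans (by gcongr)

theorem norm_add_pow_sub_pow_le (a b : A) (n : ℕ) :
    ‖(a + b) ^ n - a ^ n‖ ≤ (‖a‖ + ‖b‖) ^ n - ‖a‖ ^ n := by
  induction n with
  | zero => simp
  | succ n ih =>
    have e : (a + b) ^ (n + 1) - a ^ (n + 1) = ((a + b) ^ n - a ^ n) * (a + b) + a ^ n * b := by
      rw [pow_succ, pow_succ]; noncomm_ring
    calc ‖(a + b) ^ (n + 1) - a ^ (n + 1)‖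
        ≤ ‖(a + b) ^ n - a ^ n‖ * ‖a + b‖ + ‖a‖ ^ n * ‖b‖ := by
          rw [e]
          exact (norm_add_le _ _).trans
            (add_le_add (norm_mul_le _ _) (norm_pow_mul_le_pow_norm_mul _ _ _))
      _ ≤ ((‖a‖ + ‖b‖) ^ n - ‖a‖ ^ n) * (‖a‖ + ‖b‖) + ‖a‖ ^ n * ‖b‖ := by
          gcongr
          · exact (norm_nonneg _).trans ih
          · exact norm_add_le _ _
      _ = _ := by ring

/-- `F` is dominated by `exp (uX)`, `G` by `exp (vX)` and `F - G` by `exp (uX) - exp (vX)`. The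
first two bounds are on the operators of multiplication by coefficients, so that they hold for
`F = G = 1` without the assumption `‖(1 : A)‖ = 1`. -/
structure ExpMajorized (F G : PowerSeries A) (u v : ℝ) : Prop where
  nonneg : 0 ≤ v
  le : v ≤ u
  norm_mul_coeff_le : ∀ n x,
    ‖x * PowerSeries.coeff n F‖ ≤ ‖x‖ * (u ^ n / (n.factorial : ℝ))
  norm_coeff_mul_le : ∀ n x,
    ‖PowerSeries.coeff n G * x‖ ≤ v ^ n / (n.factorial : ℝ) * ‖x‖
  norm_coeff_sub_le : ∀ n,
    ‖PowerSeries.coeff n F - PowerSeries.coeff n G‖ ≤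
      u ^ n / (n.factorial : ℝ) - v ^ n / (n.factorial : ℝ)

theorem norm_mul_coeff_formalExp_le (a x : A) (n : ℕ) :
    ‖x * PowerSeries.coeff n (formalExp a)‖ ≤ ‖x‖ * (‖a‖ ^ n / (n.factorial : ℝ)) := by
  rw [coeff_formalExp, mul_smul_comm, norm_smul, norm_inv, Real.norm_natCast, mul_div_assoc',
    div_eq_inv_mul]
  gcongr
  exact norm_mul_pow_le x a n

theorem norm_coeff_formalExp_mul_le (a x : A) (n : ℕ) :
    ‖PowerSeries.coeff n (formalExp a) * x‖ ≤ ‖a‖ ^ n / (n.factorial : ℝ) * ‖x‖ := by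
  rw [coeff_formalExp, smul_mul_assoc, norm_smul, norm_inv, Real.norm_natCast, div_mul_eq_mul_div,
    div_eq_inv_mul]
  gcongr
  exact norm_pow_mul_le_pow_norm_mul a x n

theorem norm_coeff_formalExp_add_sub_le (a b : A) (n : ℕ) :
    ‖PowerSeries.coeff n (formalExp (a + b)) - PowerSeries.coeff n (formalExp a)‖ ≤
      (‖a‖ + ‖b‖) ^ n / (n.factorial : ℝ) - ‖a‖ ^ n / (n.factorial : ℝ) := by
  rw [coeff_formalExp, coeff_formalExp, ← smul_sub, norm_smul, norm_inv, Real.norm_natCast,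
    ← sub_div, div_eq_inv_mul]
  gcongr
  exact norm_add_pow_sub_pow_le a b n

namespace ExpMajorized

theorem formalExp_self (a : A) : ExpMajorized (formalExp a) (formalExp a) ‖a‖ ‖a‖ where
  nonneg := norm_nonneg a
  le := le_rfl
  norm_mul_coeff_le n x := norm_mul_coeff_formalExp_le a x n
  norm_coeff_mul_le n x := norm_coeff_formalExp_mul_le a x n
  norm_coeff_sub_le n := by simp

theorem formalExp_zero_right (b : A) : ExpMajorized (formalExp b) (formalExp 0) ‖b‖ 0 where
  nonneg := le_rfl
  le := norm_nonneg b
  norm_mul_coeff_le n x := norm_mul_coeff_formalExp_le b x n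
  norm_coeff_mul_le n x := by simpa using norm_coeff_formalExp_mul_le (0 : A) x n
  norm_coeff_sub_le n := by simpa using norm_coeff_formalExp_add_sub_le (0 : A) b n

/-- The splitting `f₁ f₂ - g₁ g₂ = (f₁ - g₁) f₂ + g₁ (f₂ - g₂)` also holds for the majorants, so
nothing is lost. It only multiplies by `F` on the right and by `G` on the left, whence the one-sided
bounds. -/
theorem mul {F₁ G₁ F₂ G₂ : PowerSeries A} {u₁ v₁ u₂ v₂ : ℝ} (h₁ : ExpMajorized F₁ G₁ u₁ v₁)
    (h₂ : ExpMajorized F₂ G₂ u₂ v₂) : ExpMajorized (F₁ * F₂) (G₁ * G₂) (u₁ + u₂) (v₁ + v₂) where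
  nonneg := add_nonneg h₁.nonneg h₂.nonneg
  le := add_le_add h₁.le h₂.le
  norm_mul_coeff_le n x := by
    have hu : 0 ≤ u₂ := h₂.nonneg.trans h₂.le
    rw [PowerSeries.coeff_mul, Finset.mul_sum, ← sum_antidiagonal_pow_div_factorial,
      Finset.mul_sum]
    refine norm_sum_le_of_le _ fun p _ => ?_
    rw [← mul_assoc, ← mul_assoc]
    exact (h₂.norm_mul_coeff_le _ _).trans (by gcongr; exact h₁.norm_mul_coeff_le _ _)
  norm_coeff_mul_le n x := by
    have hv : 0 ≤ v₁ := h₁.nonneg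
    rw [PowerSeries.coeff_mul, Finset.sum_mul, ← sum_antidiagonal_pow_div_factorial,
      Finset.sum_mul]
    refine norm_sum_le_of_le _ fun p _ => ?_
    rw [mul_assoc, mul_assoc]
    exact (h₁.norm_coeff_mul_le _ _).trans (by gcongr; exact h₂.norm_coeff_mul_le _ _)
  norm_coeff_sub_le n := by
    have hu : 0 ≤ u₂ := h₂.nonneg.trans h₂.le
    have hv : 0 ≤ v₁ := h₁.nonneg
    rw [PowerSeries.coeff_mul, PowerSeries.coeff_mul, ← Finset.sum_sub_distrib,
      ← sum_antidiagonal_pow_div_factorial, ← sum_antidiagonal_pow_div_factorial,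
      ← Finset.sum_sub_distrib]
    refine norm_sum_le_of_le _ fun p _ => ?_
    set f₁ := PowerSeries.coeff p.1 F₁
    set g₁ := PowerSeries.coeff p.1 G₁
    set f₂ := PowerSeries.coeff p.2 F₂
    set g₂ := PowerSeries.coeff p.2 G₂
    have e : f₁ * f₂ - g₁ * g₂ = (f₁ - g₁) * f₂ + g₁ * (f₂ - g₂) := by noncomm_ring
    rw [e]
    have b₁ : ‖(f₁ - g₁) * f₂‖ ≤ (u₁ ^ p.1 / (p.1.factorial : ℝ) - v₁ ^ p.1 / (p.1.factorial : ℝ)) *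
        (u₂ ^ p.2 / (p.2.factorial : ℝ)) :=
      (h₂.norm_mul_coeff_le _ _).trans (by gcongr; exact h₁.norm_coeff_sub_le _)
    have b₂ : ‖g₁ * (f₂ - g₂)‖ ≤ v₁ ^ p.1 / (p.1.factorial : ℝ) *
        (u₂ ^ p.2 / (p.2.factorial : ℝ) - v₂ ^ p.2 / (p.2.factorial : ℝ)) :=
      (h₁.norm_coeff_mul_le _ _).trans (by gcongr; exact h₂.norm_coeff_sub_le _)
    linarith [norm_add_le ((f₁ - g₁) * f₂) (g₁ * (f₂ - g₂))]

theorem dilate {F G : PowerSeries A} {u v : ℝ} (h : ExpMajorized F G u v) (c : ℝ) :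
    ExpMajorized (dilate c F) (dilate c G) (|c| * u) (|c| * v) where
  nonneg := mul_nonneg (abs_nonneg c) h.nonneg
  le := mul_le_mul_of_nonneg_left h.le (abs_nonneg c)
  norm_mul_coeff_le n x := by
    rw [coeff_dilate, mul_smul_comm, norm_smul, norm_pow, Real.norm_eq_abs, mul_pow]
    calc _ ≤ |c| ^ n * (‖x‖ * (u ^ n / (n.factorial : ℝ))) := by
          gcongr; exact h.norm_mul_coeff_le n x
      _ = _ := by ring
  norm_coeff_mul_le n x := by
    rw [coeff_dilate, smul_mul_assoc, norm_smul, norm_pow, Real.norm_eq_abs, mul_pow]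
    calc _ ≤ |c| ^ n * (v ^ n / (n.factorial : ℝ) * ‖x‖) := by
          gcongr; exact h.norm_coeff_mul_le n x
      _ = _ := by ring
  norm_coeff_sub_le n := by
    rw [coeff_dilate, coeff_dilate, ← smul_sub, norm_smul, norm_pow, Real.norm_eq_abs, mul_pow,
      mul_pow]
    calc _ ≤ |c| ^ n * (u ^ n / (n.factorial : ℝ) - v ^ n / (n.factorial : ℝ)) := by
          gcongr; exact h.norm_coeff_sub_le n
      _ = _ := by ring

end ExpMajorized

/-! ### Order of agreement. -/

/-- `F = E + r X ^ m + O(X ^ (m + 1))`, where `E` has constant coefficient `1`. -/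
structure AgreesTo (F E : PowerSeries A) (m : ℕ) (r : A) : Prop where
  coeff_zero : PowerSeries.coeff 0 E = 1
  coeff_of_lt : ∀ n < m, PowerSeries.coeff n F = PowerSeries.coeff n E
  coeff_eq : PowerSeries.coeff m F = PowerSeries.coeff m E + r

namespace AgreesTo

/-- All constant coefficients are 1, so the leading errors simply add. -/
theorem mul {F₁ E₁ F₂ E₂ : PowerSeries A} {m : ℕ} {r₁ r₂ : A} (hm : m ≠ 0)
    (h₁ : AgreesTo F₁ E₁ m r₁) (h₂ : AgreesTo F₂ E₂ m r₂) :
    AgreesTo (F₁ * F₂) (E₁ * E₂) m (r₁ + r₂) where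
  coeff_zero := by simp [PowerSeries.coeff_mul, h₁.coeff_zero, h₂.coeff_zero]
  coeff_of_lt n hn := by
    rw [PowerSeries.coeff_mul, PowerSeries.coeff_mul]
    refine Finset.sum_congr rfl fun p hp => ?_
    have hp := mem_antidiagonal.1 hp
    rw [h₁.coeff_of_lt _ (by omega), h₂.coeff_of_lt _ (by omega)]
  coeff_eq := by
    obtain ⟨m, rfl⟩ := Nat.exists_eq_succ_of_ne_zero hm
    have z₁ : PowerSeries.coeff 0 F₁ = 1 := by
      rw [h₁.coeff_of_lt 0 (by omega), h₁.coeff_zero]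
    rw [PowerSeries.coeff_mul, PowerSeries.coeff_mul, Finset.Nat.sum_antidiagonal_succ,
      Finset.Nat.sum_antidiagonal_succ]
    have key : ∀ G₁ G₂ : PowerSeries A, PowerSeries.coeff 0 G₂ = 1 →
        ∑ p ∈ antidiagonal m, PowerSeries.coeff (p.1 + 1) G₁ * PowerSeries.coeff p.2 G₂ =
          PowerSeries.coeff (m + 1) G₁ + ∑ p ∈ (antidiagonal m).erase (m, 0),
            PowerSeries.coeff (p.1 + 1) G₁ * PowerSeries.coeff p.2 G₂ := by
      intro G₁ G₂ h
      rw [← Finset.add_sum_erase _ _ (show (m, 0) ∈ antidiagonal m by simp)]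
      simp [h]
    have z₂ : PowerSeries.coeff 0 F₂ = 1 := by
      rw [h₂.coeff_of_lt 0 (by omega), h₂.coeff_zero]
    rw [key F₁ F₂ z₂, key E₁ E₂ h₂.coeff_zero, z₁, h₁.coeff_zero, h₁.coeff_eq, h₂.coeff_eq]
    have : ∑ p ∈ (antidiagonal m).erase (m, 0),
          PowerSeries.coeff (p.1 + 1) F₁ * PowerSeries.coeff p.2 F₂ =
        ∑ p ∈ (antidiagonal m).erase (m, 0),
          PowerSeries.coeff (p.1 + 1) E₁ * PowerSeries.coeff p.2 E₂ := by
      refine Finset.sum_congr rfl fun p hp => ?_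
      obtain ⟨hne, hp⟩ := Finset.mem_erase.1 hp
      have hp := mem_antidiagonal.1 hp
      have : p.1 ≠ m := fun h => hne (Prod.ext h (by simp only; omega))
      rw [h₁.coeff_of_lt _ (by omega), h₂.coeff_of_lt _ (by omega)]
    rw [this, one_mul, one_mul, Nat.succ_eq_add_one]
    abel

theorem dilate {F E : PowerSeries A} {m : ℕ} {r : A} (h : AgreesTo F E m r) (c : ℝ) :
    AgreesTo (dilate c F) (dilate c E) m (c ^ m • r) where
  coeff_zero := by simpa using h.coeff_zero
  coeff_of_lt n hn := by rw [coeff_dilate, coeff_dilate, h.coeff_of_lt n hn]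
  coeff_eq := by rw [coeff_dilate, coeff_dilate, h.coeff_eq, smul_add]

theorem succ {F E : PowerSeries A} {m : ℕ} (h : AgreesTo F E m 0) :
    AgreesTo F E (m + 1) (PowerSeries.coeff (m + 1) F - PowerSeries.coeff (m + 1) E) where
  coeff_zero := h.coeff_zero
  coeff_of_lt n hn := by
    rcases Nat.lt_succ_iff_lt_or_eq.1 hn with hn | rfl
    · exact h.coeff_of_lt n hn
    · simpa using h.coeff_eq
  coeff_eq := by abel

/-- A time-symmetric approximation has even order. -/
theorem eq_zero_of_even {F E : PowerSeries A} {m : ℕ} {r : A} (hm : m ≠ 0) (hev : Even m)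
    (h : AgreesTo F E m r) (hF : F * _root_.dilate (-1) F = 1) (hE : E * _root_.dilate (-1) E = 1) :
    r = 0 := by
  -- `F(X) F(-X)` and `E(X) E(-X)` differ in degree `m` by `r + (-1) ^ m r = 2r`, yet both equal 1.
  have := (h.mul hm (h.dilate (-1))).coeff_eq
  rw [hF, hE, hev.neg_one_pow, one_smul, left_eq_add, ← two_smul ℝ] at this
  simpa using this

end AgreesTo

theorem formalExp_mul_dilate_neg_one (a : A) : formalExp a * dilate (-1) (formalExp a) = 1 := by
  rw [dilate_formalExp]
  have := formalExp_smul_mul_smul a 1 (-1)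
  simpa using this

theorem agreesTo_formalExp (a : A) : AgreesTo (formalExp a) 1 1 a where
  coeff_zero := by simp
  coeff_of_lt n hn := by
    obtain rfl : n = 0 := by omega
    simp
  coeff_eq := by simp [PowerSeries.coeff_one]

/-! ### Order of the Suzuki approximants. -/

/-- The composition `F(pX)² F((1-4p)X) F(pX)²`. -/
noncomputable def suzukiStep (p : ℝ) (F : PowerSeries A) : PowerSeries A :=
  dilate p F ^ 2 * dilate (1 - 4 * p) F * dilate p F ^ 2

/-- The formal power series of the Suzuki approximant of order `2 (k + 1)` to
`exp ((a + b) X)`. -/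
noncomputable def suzukiSeries (a b : A) : ℕ → PowerSeries A
  | 0 => formalExp ((1 / 2 : ℝ) • a) * formalExp b * formalExp ((1 / 2 : ℝ) • a)
  | k + 1 => suzukiStep (suzukiP (k + 2)) (suzukiSeries a b k)

theorem suzukiStep_formalExp (p : ℝ) (a : A) : suzukiStep p (formalExp a) = formalExp a := by
  simp only [suzukiStep, dilate_formalExp, pow_two, formalExp_smul_mul_smul]
  ring_nf
  rw [one_smul]

theorem suzukiSeries_zero_right (a : A) (k : ℕ) : suzukiSeries a 0 k = formalExp a := by
  induction k with
  | zero =>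
    rw [suzukiSeries, formalExp_zero, mul_one, formalExp_smul_mul_smul]
    norm_num
  | succ k ih => rw [suzukiSeries, ih, suzukiStep_formalExp]

/-- The composition is a palindrome and time reversal inverts each factor, so the product collapses
from the middle. -/
theorem suzukiStep_mul_dilate_neg_one (p : ℝ) {F : PowerSeries A}
    (h : F * dilate (-1) F = 1) : suzukiStep p F * dilate (-1) (suzukiStep p F) = 1 := by
  have key : ∀ c : ℝ, dilate c F * dilate (-c) F = 1 := fun c => by
    rw [show (-c : ℝ) = c * (-1) by ring, ← dilate_dilate, ← map_mul, h, map_one]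
  have h₁ := key p
  have h₂ := key (1 - 4 * p)
  simp only [suzukiStep, map_mul, map_pow, dilate_dilate, neg_one_mul]
  simp only [pow_two, mul_assoc]
  simp only [← mul_assoc (dilate p F) (dilate (-p) F), h₁, one_mul,
    ← mul_assoc (dilate (1 - 4 * p) F) (dilate (-(1 - 4 * p)) F), h₂]

theorem suzukiSeries_mul_dilate_neg_one (a b : A) (k : ℕ) :
    suzukiSeries a b k * dilate (-1) (suzukiSeries a b k) = 1 := by
  induction k with
  | zero =>
    have h₁ := formalExp_mul_dilate_neg_one ((1 / 2 : ℝ) • a)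
    have h₂ := formalExp_mul_dilate_neg_one b
    simp only [suzukiSeries, map_mul, mul_assoc]
    rw [← mul_assoc (formalExp ((1 / 2 : ℝ) • a)) (dilate (-1) (formalExp ((1 / 2 : ℝ) • a))), h₁,
      one_mul, ← mul_assoc (formalExp b), h₂, one_mul, h₁]
  | succ k ih => exact suzukiStep_mul_dilate_neg_one _ ih

theorem AgreesTo.suzukiStep {F : PowerSeries A} {a r : A} {m : ℕ} (hm : m ≠ 0)
    (h : AgreesTo F (formalExp a) m r) (p : ℝ) :
    AgreesTo (suzukiStep p F) (formalExp a) m ((4 * p ^ m + (1 - 4 * p) ^ m) • r) := by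
  have h₁ := h.dilate p
  have h₂ := h.dilate (1 - 4 * p)
  have h₃ := h₁.mul hm h₁
  have h₄ := (h₃.mul hm h₂).mul hm h₃
  rw [← pow_two, ← pow_two] at h₄
  have e := suzukiStep_formalExp p a
  rw [_root_.suzukiStep] at e ⊢
  rw [e] at h₄
  convert h₄ using 1
  module

theorem four_rpow_lt_four {k : ℕ} : (4 : ℝ) ^ (1 / (2 * ((k + 2 : ℕ) : ℝ) - 1)) < 4 := by
  conv_rhs => rw [← Real.rpow_one 4]
  refine Real.rpow_lt_rpow_of_exponent_lt (by norm_num) ?_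
  have : (0 : ℝ) ≤ k := k.cast_nonneg
  push_cast
  rw [div_lt_one (by linarith)]
  linarith

/-- With `q = 4 ^ (1 / (2k + 3))` and `p = 1 / (4 - q)`, one has `1 - 4p = -qp`; its odd power is
`-4 p ^ (2k + 3)`. -/
theorem suzukiP_order_condition (k : ℕ) :
    4 * suzukiP (k + 2) ^ (2 * k + 3) + (1 - 4 * suzukiP (k + 2)) ^ (2 * k + 3) = 0 := by
  have hlt := four_rpow_lt_four (k := k)
  have hq : ((4 : ℝ) ^ (1 / (2 * ((k + 2 : ℕ) : ℝ) - 1))) ^ (2 * k + 3) = 4 := by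
    rw [← Real.rpow_natCast, ← Real.rpow_mul (by norm_num)]
    have : (0 : ℝ) ≤ k := k.cast_nonneg
    rw [show 1 / (2 * ((k + 2 : ℕ) : ℝ) - 1) * ((2 * k + 3 : ℕ) : ℝ) = 1 by
      push_cast
      rw [one_div_mul_eq_div, div_eq_one_iff_eq (by linarith)]
      ring, Real.rpow_one]
  rw [suzukiP]
  set q := (4 : ℝ) ^ (1 / (2 * ((k + 2 : ℕ) : ℝ) - 1))
  have e : 1 - 4 * (4 - q)⁻¹ = -(q * (4 - q)⁻¹) := by
    have : 4 - q ≠ 0 := by linarith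
    field_simp
    ring
  rw [e, Odd.neg_pow ⟨k + 1, by ring⟩, mul_pow, hq]
  ring

theorem suzukiSeries_agreesTo (a b : A) (k : ℕ) :
    AgreesTo (suzukiSeries a b k) (formalExp (a + b)) (2 * k + 2) 0 := by
  -- Agreement through an odd degree extends to the next even degree by symmetry.
  have lift : ∀ {k m : ℕ}, m = 2 * k + 1 →
      AgreesTo (suzukiSeries a b k) (formalExp (a + b)) m 0 →
      AgreesTo (suzukiSeries a b k) (formalExp (a + b)) (m + 1) 0 := by
    intro k m hm h
    have h' := h.succ
    rwa [h'.eq_zero_of_even (by omega) ⟨k + 1, by omega⟩ (suzukiSeries_mul_dilate_neg_one a b k)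
      (formalExp_mul_dilate_neg_one (a + b))] at h'
  induction k with
  | zero =>
    refine lift (k := 0) rfl ?_
    have h₁ := agreesTo_formalExp ((1 / 2 : ℝ) • a)
    have h := (h₁.mul one_ne_zero (agreesTo_formalExp b)).mul one_ne_zero h₁
    have h₂ := agreesTo_formalExp (a + b)
    rw [mul_one, mul_one] at h
    refine ⟨by simp, fun n hn => ?_, ?_⟩
    · rw [h₂.coeff_of_lt n hn]
      exact h.coeff_of_lt n hn
    · rw [h₂.coeff_eq, suzukiSeries, h.coeff_eq]
      module
  | succ k ih =>
    refine lift (k := k + 1) (by ring) ?_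
    have h := ih.succ.suzukiStep (by omega) (suzukiP (k + 2))
    rw [suzukiP_order_condition, zero_smul] at h
    exact h

/-! ### Size of the coefficients. -/

/-- The total absolute weight of the exponents of either generator in the Suzuki approximant of
order `2 (k + 1)`. -/
noncomputable def suzukiWeight : ℕ → ℝ
  | 0 => 1
  | k + 1 => (4 * |suzukiP (k + 2)| + |1 - 4 * suzukiP (k + 2)|) * suzukiWeight k

theorem ExpMajorized.suzukiStep {F G : PowerSeries A} {u v : ℝ} (h : ExpMajorized F G u v)
    (p : ℝ) : ExpMajorized (suzukiStep p F) (suzukiStep p G)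
      ((4 * |p| + |1 - 4 * p|) * u) ((4 * |p| + |1 - 4 * p|) * v) := by
  have h₁ := (h.dilate p).mul (h.dilate p)
  have h₂ := (h₁.mul (h.dilate (1 - 4 * p))).mul h₁
  rw [_root_.suzukiStep, _root_.suzukiStep, pow_two, pow_two]
  convert h₂ using 1 <;> ring

theorem suzukiSeries_expMajorized (a b : A) (k : ℕ) :
    ExpMajorized (suzukiSeries a b k) (formalExp a)
      (suzukiWeight k * (‖a‖ + ‖b‖)) (suzukiWeight k * ‖a‖) := by
  -- Written as the approximant with `b = 0`, `exp (aX)` factors in parallel with the other series,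
  -- and only the `b` factors differ.
  rw [← suzukiSeries_zero_right a k]
  induction k with
  | zero =>
    have h₁ := ExpMajorized.formalExp_self ((1 / 2 : ℝ) • a)
    have h := (h₁.mul (ExpMajorized.formalExp_zero_right b)).mul h₁
    have e : ‖(1 / 2 : ℝ) • a‖ = 1 / 2 * ‖a‖ := by rw [norm_smul]; norm_num
    rw [e] at h
    rw [suzukiSeries, suzukiSeries, suzukiWeight]
    convert h using 1 <;> ring
  | succ k ih =>
    simpa only [suzukiSeries, suzukiWeight, mul_assoc] using ih.suzukiStep (suzukiP (k + 2))

/-- Bernoulli: `(1 + 3) ^ s ≤ 1 + 3s` with `s = 1 / (2k + 3)`. -/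
theorem suzukiP_le (k : ℕ) : suzukiP (k + 2) ≤ (2 * k + 3) / (6 * (k + 1)) := by
  have hk : (0 : ℝ) ≤ k := k.cast_nonneg
  have h := rpow_one_add_le_one_add_mul_self (s := 3) (p := 1 / (2 * ((k + 2 : ℕ) : ℝ) - 1))
    (by norm_num) (by push_cast; apply div_nonneg <;> linarith)
    (by push_cast; rw [div_le_one (by linarith)]; linarith)
  norm_num only at h
  have e : (6 * ((k : ℝ) + 1) / (2 * k + 3)) = 4 - (1 + 1 / (2 * ((k + 2 : ℕ) : ℝ) - 1) * 3) := by
    have h₁ : 2 * (k : ℝ) + 3 ≠ 0 := by linarith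
    have h₂ : 2 * ((k + 2 : ℕ) : ℝ) - 1 = 2 * k + 3 := by push_cast; ring
    rw [h₂]
    field_simp
    ring
  rw [suzukiP, ← inv_div (6 * ((k : ℝ) + 1)), e]
  refine inv_anti₀ ?_ (by linarith)
  rw [← e]
  positivity

theorem one_third_le_suzukiP (k : ℕ) : 1 / 3 ≤ suzukiP (k + 2) := by
  have hlt := four_rpow_lt_four (k := k)
  have h1 : (1 : ℝ) ≤ (4 : ℝ) ^ (1 / (2 * ((k + 2 : ℕ) : ℝ) - 1)) := by
    have hk : (0 : ℝ) ≤ k := k.cast_nonneg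
    refine Real.one_le_rpow (by norm_num) ?_
    push_cast
    apply div_nonneg <;> linarith
  rw [suzukiP, one_div]
  exact inv_anti₀ (by linarith) (by linarith)

theorem suzukiWeight_nonneg (k : ℕ) : 0 ≤ suzukiWeight k := by
  induction k with
  | zero => simp [suzukiWeight]
  | succ k ih => rw [suzukiWeight]; positivity

/-- Each step multiplies the weight by `8p - 1 ≤ (5/3) (k + 2) / (k + 1)`, and these bounds
telescope. -/
theorem suzukiWeight_le (k : ℕ) : suzukiWeight k ≤ (k + 1) * (5 / 3) ^ k := by
  induction k with
  | zero => simp [suzukiWeight]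
  | succ k ih =>
    have hk : (0 : ℝ) ≤ k := k.cast_nonneg
    have h₁ := suzukiP_le k
    have h₂ := one_third_le_suzukiP k
    have h₃ : 4 * |suzukiP (k + 2)| + |1 - 4 * suzukiP (k + 2)| ≤ 5 / 3 * (k + 2) / (k + 1) := by
      rw [abs_of_nonneg (by linarith), abs_of_nonpos (by linarith), le_div_iff₀ (by positivity)]
      rw [le_div_iff₀ (by positivity)] at h₁
      linarith
    calc suzukiWeight (k + 1) ≤ 5 / 3 * (k + 2) / (k + 1) * ((k + 1) * (5 / 3) ^ k) := by
          rw [suzukiWeight]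
          gcongr
          exact suzukiWeight_nonneg k
      _ = _ := by
          push_cast
          field_simp
          ring

theorem one_add_pow_sub_one_le {h : ℝ} (h₀ : 0 ≤ h) (h₁ : h ≤ 1) (n : ℕ) :
    (1 + h) ^ n - 1 ≤ h * 2 ^ n := by
  induction n with
  | zero => simpa using h₀
  | succ n ih =>
    have : (1 + h) ^ n ≤ 2 ^ n := by gcongr; linarith
    rw [pow_succ, pow_succ]
    nlinarith

theorem norm_coeff_formalExp_sub_suzukiSeries_le (a b : A) (ha : ‖a‖ = 1) (hb : ‖b‖ ≤ 1) (k n : ℕ) :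
    ‖PowerSeries.coeff n (formalExp (a + b)) - PowerSeries.coeff n (suzukiSeries a b k)‖ ≤
      2 * ‖b‖ * (suzukiC (k + 1) ^ n / (n.factorial : ℝ)) := by
  have h₁ := norm_coeff_formalExp_add_sub_le a b n
  have h₂ := (suzukiSeries_expMajorized a b k).norm_coeff_sub_le n
  have h₃ := norm_sub_le_norm_sub_add_norm_sub (PowerSeries.coeff n (formalExp (a + b)))
    (PowerSeries.coeff n (formalExp a)) (PowerSeries.coeff n (suzukiSeries a b k))
  rw [norm_sub_rev] at h₂
  rw [ha] at h₁ h₂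
  have h₀ := norm_nonneg b
  have h₄ := one_add_pow_sub_one_le h₀ hb n
  have hΛ : (1 : ℝ) ≤ (k + 1) * (5 / 3) ^ k := by
    have hk : (0 : ℝ) ≤ k := k.cast_nonneg
    exact one_le_mul_of_one_le_of_one_le (by linarith) (one_le_pow₀ (by norm_num))
  -- Only `2Λ ≤ suzukiC (k + 1)` is needed: `Λ` bounds the weight, 2 comes from `(1 + ‖b‖) ^ n - 1 ≤
  -- ‖b‖ 2 ^ n`, and 4/3 is slack.
  have hC : suzukiC (k + 1) = 4 / 3 * (2 * ((k + 1) * (5 / 3) ^ k)) := by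
    rw [suzukiC, Nat.add_sub_cancel]; push_cast; ring
  have hw := suzukiWeight_le k
  generalize (k + 1 : ℝ) * (5 / 3) ^ k = Λ at hΛ hC hw
  have h₅ : suzukiWeight k ^ n ≤ Λ ^ n := pow_le_pow_left₀ (suzukiWeight_nonneg k) hw n
  have h₆ : (1 : ℝ) ≤ Λ ^ n := one_le_pow₀ hΛ
  have h₇ : (2 * Λ) ^ n ≤ suzukiC (k + 1) ^ n := 
    pow_le_pow_left₀ (by linarith) (by linarith) n
  have h₈ : (0 : ℝ) ≤ (1 + ‖b‖) ^ n - 1 := by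
    have : (1 : ℝ) ≤ (1 + ‖b‖) ^ n := one_le_pow₀ (by linarith)
    linarith
  have key : ((1 + ‖b‖) ^ n - 1) + suzukiWeight k ^ n * ((1 + ‖b‖) ^ n - 1) ≤
      2 * ‖b‖ * suzukiC (k + 1) ^ n := by
    calc ((1 + ‖b‖) ^ n - 1) + suzukiWeight k ^ n * ((1 + ‖b‖) ^ n - 1)
        ≤ Λ ^ n * ((1 + ‖b‖) ^ n - 1) + Λ ^ n * ((1 + ‖b‖) ^ n - 1) := by
          gcongr
          exact le_mul_of_one_le_left h₈ h₆
      _ ≤ Λ ^ n * (‖b‖ * 2 ^ n) + Λ ^ n * (‖b‖ * 2 ^ n) := by gcongr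
      _ = 2 * ‖b‖ * (2 * Λ) ^ n := by rw [mul_pow]; ring
      _ ≤ _ := by gcongr
  have key' := div_le_div_of_nonneg_right key (Nat.cast_nonneg n.factorial : (0 : ℝ) ≤ _)
  calc _ ≤ _ := h₃
    _ ≤ _ := add_le_add h₁ h₂
    _ = ((1 + ‖b‖) ^ n - 1 + suzukiWeight k ^ n * ((1 + ‖b‖) ^ n - 1)) / (n.factorial : ℝ) := by
        rw [mul_pow, mul_one]; ring
    _ ≤ _ := key'
    _ = _ := by ring

/-! ### From formal series to functions of time. -/

/-- The power series `F` converges absolutely on the whole real line, with sum `f`. -/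
def SumsTo (F : PowerSeries A) (f : ℝ → A) : Prop :=
  ∀ t : ℝ, Summable (fun n => ‖t ^ n • PowerSeries.coeff n F‖) ∧
    HasSum (fun n => t ^ n • PowerSeries.coeff n F) (f t)

namespace SumsTo

theorem mul [CompleteSpace A] {F G : PowerSeries A} {f g : ℝ → A} (hF : SumsTo F f)
    (hG : SumsTo G g) : SumsTo (F * G) (fun t => f t * g t) := by
  intro t
  have e : ∀ n, t ^ n • PowerSeries.coeff n (F * G) = ∑ p ∈ antidiagonal n,
      (t ^ p.1 • PowerSeries.coeff p.1 F) * (t ^ p.2 • PowerSeries.coeff p.2 G) := by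
    intro n
    rw [PowerSeries.coeff_mul, Finset.smul_sum]
    refine Finset.sum_congr rfl fun p hp => ?_
    rw [smul_mul_smul_comm, ← pow_add, mem_antidiagonal.1 hp]
  simp only [e]
  have hs := summable_norm_sum_mul_antidiagonal_of_summable_norm (hF t).1 (hG t).1
  refine ⟨hs, ?_⟩
  rw [← (hF t).2.tsum_eq, ← (hG t).2.tsum_eq,
    tsum_mul_tsum_eq_tsum_sum_antidiagonal_of_summable_norm (hF t).1 (hG t).1]
  exact hs.of_norm.hasSum

theorem dilate {F : PowerSeries A} {f : ℝ → A} (hF : SumsTo F f) (c : ℝ) :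
    SumsTo (dilate c F) (fun t => f (c * t)) := by
  intro t
  have := hF (c * t)
  simpa only [coeff_dilate, smul_smul, mul_pow, mul_comm] using this

theorem suzukiStep [CompleteSpace A] {F : PowerSeries A} {f : ℝ → A} (hF : SumsTo F f) (p : ℝ) :
    SumsTo (suzukiStep p F)
      (fun t => f (p * t) ^ 2 * f ((1 - 4 * p) * t) * f (p * t) ^ 2) := by
  simp only [_root_.suzukiStep, pow_two]
  have h₁ := (hF.dilate p).mul (hF.dilate p)
  exact (h₁.mul (hF.dilate (1 - 4 * p))).mul h₁

end SumsTo

theorem sumsTo_formalExp [CompleteSpace A] (a : A) :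
    SumsTo (formalExp a) (fun t => NormedSpace.exp (t • a)) := by
  intro t
  have e : ∀ n, t ^ n • PowerSeries.coeff n (formalExp a) =
      ((n.factorial : ℝ)⁻¹) • (t • a) ^ n := fun n => by
    rw [coeff_formalExp, smul_pow, smul_comm]
  simp only [e]
  exact ⟨NormedSpace.norm_expSeries_summable' (𝕂 := ℝ) (t • a),
    NormedSpace.exp_series_hasSum_exp' (𝕂 := ℝ) (t • a)⟩

/-- Since `(N + j)! ≥ N! (N + 1) ^ j` and `x / (N + 1) ≤ 1/2`, the tail is at most twice its first
majorant. -/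
theorem norm_le_of_hasSum_pow_div_factorial {f : ℕ → A} {s : A} (hf : HasSum f s) {N : ℕ}
    {K x : ℝ} (hK : 0 ≤ K) (hx₀ : 0 ≤ x) (hx : 2 * x ≤ N + 1) (hlt : ∀ n < N, f n = 0)
    (hle : ∀ n, ‖f n‖ ≤ K * (x ^ n / (n.factorial : ℝ))) :
    ‖s‖ ≤ 2 * K * (x ^ N / (N.factorial : ℝ)) := by
  have hs : HasSum (fun j => f (j + N)) s := by
    rw [hasSum_nat_add_iff, Finset.sum_eq_zero fun n hn => hlt n (Finset.mem_range.1 hn), add_zero]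
    exact hf
  have hg := hasSum_geometric_two.mul_left (K * (x ^ N / (N.factorial : ℝ)))
  have hb : ∀ j, ‖f (j + N)‖ ≤ K * (x ^ N / (N.factorial : ℝ)) * (1 / 2) ^ j := by
    intro j
    refine (hle _).trans ?_
    rw [mul_assoc]
    gcongr
    have hfac : (N.factorial : ℝ) * (N + 1) ^ j ≤ ((j + N).factorial : ℝ) := by
      rw [add_comm j N]
      exact_mod_cast Nat.factorial_mul_pow_le_factorial
    have hN : (0 : ℝ) < N.factorial := by exact_mod_cast N.factorial_pos
    calc x ^ (j + N) / ((j + N).factorial : ℝ)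
        ≤ x ^ (j + N) / ((N.factorial : ℝ) * (N + 1) ^ j) := by gcongr
      _ = x ^ N / (N.factorial : ℝ) * (x / (N + 1)) ^ j := by
          rw [pow_add, div_pow]; field_simp
      _ ≤ x ^ N / (N.factorial : ℝ) * (1 / 2) ^ j := by
          gcongr ?_ * ?_ ^ j
          rw [div_le_div_iff₀ (by positivity) (by norm_num)]
          linarith
  have := hs.norm_le_of_bounded hg hb
  linarith

end Series

/-! ### Propagators in a complex Banach algebra. -/

section Complex

variable {A : Type*} [NormedRing A] [NormedAlgebra ℂ A] [CompleteSpace A]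

/-- Absorbing `-i` into the generator leaves a real time variable, so the real theory applies. -/
theorem sumsTo_propagator (H : A) : SumsTo (formalExp (-(Complex.I • H))) (propagator H) := by
  convert sumsTo_formalExp (-(Complex.I • H)) using 2 with t
  rw [propagator, smul_neg, ← Complex.coe_smul, smul_smul, neg_smul, mul_comm]

theorem sumsTo_suzuki (H₁ H₂ : A) (k : ℕ) :
    SumsTo (suzukiSeries (-(Complex.I • H₁)) (-(Complex.I • H₂)) k) (suzuki H₁ H₂ (k + 1)) := by
  induction k with
  | zero =>
    have h₁ := (sumsTo_propagator H₁).dilate (1 / 2)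
    rw [dilate_formalExp] at h₁
    have h := (h₁.mul (sumsTo_propagator H₂)).mul h₁
    simp only [one_div_mul_eq_div] at h
    exact h
  | succ k ih => exact ih.suzukiStep (suzukiP (k + 2))

end Complex

/-- `A` is any complex Banach algebra with a unit, for instance the complex `n × n` matrices with
any submultiplicative norm, or the bounded operators on a Hilbert space; the bound holds for
all `H₁ H₂ : A`, in particular for Hermitian ones. Only submultiplicativity of the norm is used:
`‖(1 : A)‖ = 1` is not assumed. -/
theorem lemma1 {A : Type*} [NormedRing A] [NormedAlgebra ℂ A] [CompleteSpace A]
    (H₁ H₂ : A) (hH₁ : ‖H₁‖ = 1) (hH₂ : ‖H₂‖ ≤ ‖H₁‖)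
    (k : ℕ) (hk : 1 ≤ k) (Δt : ℝ) (hΔt : suzukiC k * |Δt| ≤ (k : ℝ) + 1) :
    ‖propagator (H₁ + H₂) Δt - suzuki H₁ H₂ k Δt‖ ≤
      4 * ‖H₂‖ / (Nat.factorial (2 * k + 1) : ℝ) * (suzukiC k * |Δt|) ^ (2 * k + 1) := by

  obtain ⟨k, rfl⟩ := Nat.exists_eq_add_of_le' hk
  have hn : ∀ H : A, ‖-(Complex.I • H)‖ = ‖H‖ := fun H => by simp [norm_smul]
  have hC : 0 ≤ suzukiC (k + 1) := by rw [suzukiC]; positivity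
  have hadd : -(Complex.I • (H₁ + H₂)) = -(Complex.I • H₁) + -(Complex.I • H₂) := by
    rw [smul_add, neg_add]
  have hE := (sumsTo_propagator (H₁ + H₂) Δt).2
  rw [hadd] at hE
  have hs := hE.sub (sumsTo_suzuki H₁ H₂ k Δt).2
  have hagree := suzukiSeries_agreesTo (-(Complex.I • H₁)) (-(Complex.I • H₂)) k
  have hbound := norm_coeff_formalExp_sub_suzukiSeries_le (-(Complex.I • H₁)) (-(Complex.I • H₂))
    (by rw [hn, hH₁]) (by rw [hn]; exact hH₂.trans hH₁.le) k
  rw [hn] at hbound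
  push_cast at hΔt
  -- Here `N + 1 = 2(k + 2)`, so `2x ≤ N + 1` is exactly the hypothesis on `Δt`.
  refine (norm_le_of_hasSum_pow_div_factorial hs (N := 2 * (k + 1) + 1) (K := 2 * ‖H₂‖)
    (x := suzukiC (k + 1) * |Δt|) (by positivity) (by positivity) (by push_cast; linarith)
    (fun n hlt => ?_) fun n => ?_).trans_eq (by ring)
  · rw [← smul_sub, hagree.succ.coeff_of_lt n hlt, sub_self, smul_zero]
  · rw [← smul_sub, norm_smul, norm_pow, Real.norm_eq_abs]
    calc _ ≤ |Δt| ^ n * (2 * ‖H₂‖ * (suzukiC (k + 1) ^ n / (n.factorial : ℝ))) := by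
          gcongr; exact hbound n
      _ = _ := by rw [mul_pow]; ring
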